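/- Let $p$ be a prime, $L=\mathbb F_{p^m}$, and let $\sigma\colon x\mapsto x^{p^k}$, $\tau\colon x\mapsto x^{p^l}$ be field automorphisms of $L$ with integers $0\le k,l<m/2$ and $k\neq l$; write $\overline\tau=\tau^{-1}$. For $\alpha,\eta\in L$ let $\mathcal S_{\sigma,\tau,\alpha,\eta}$ denote $L^2$ with its usual addition and the multiplication $$\begin{pmatrix}x_0\\x_1\end{pmatrix}\circ\begin{pmatrix}y_0\\y_1\end{pmatrix}=\begin{pmatrix}x_1y_1^{\sigma}-\eta x_1^{\sigma}y_1+\alpha\,(x_0y_0^{\sigma}-\eta x_0^{\sigma}y_0)\\ x_0^{\tau}y_1+x_1y_0^{\tau}\end{pmatrix},$$ and let $\mathcal S'_{\sigma,\tau,\alpha,\eta}$ denote $L^2$ with the multiplication $$\begin{pmatrix}x_0\\x_1\end{pmatrix}\circ'\begin{pmatrix}y_0\\y_1\end{pmatrix}=\begin{pmatrix}x_1y_1^{\sigma}-\eta x_1^{\sigma}y_1+\alpha\,(x_0y_0^{\sigma}-\eta^{\overline\tau} x_0^{\sigma}y_0)\\ x_0^{\tau}y_1+x_1y_0^{\tau}\end{pmatrix}.$$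 A finite additive group with a multiplication that is distributive on both sides and has no zero divisors is called a (pre-)semifield. Two (pre-)semifields $(\mathbb F_p^n,+,\circ_1)$ and $(\mathbb F_p^n,+,\circ_2)$ are isotopic if there are $\mathbb F_p$-linear bijections $N_1,N_2,N_3$ with $N_1(x\circ_1y)=N_2(x)\circ_2N_3(y)$ for all $x,y$. Let $\alpha_1,\eta_1,\alpha_2,\eta_2\in L$. 1. If $\mathcal S_{\sigma,\tau,\alpha_1,\eta_1}$ and $\mathcal S_{\tau,\sigma,\alpha_2,\eta_2}$ are (pre-)semifields, then they are not isotopic. 2. If $\mathcal S'_{\sigma,\tau,\alpha_1,\eta_1}$ and $\mathcal S'_{\tau,\sigma,\alpha_2,\eta_2}$ are (pre-)semifields, then they are not isotopic. -/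

import Mathlib

/-- A binary operation on an additive commutative group `E` makes it a pre-semifield if it is
left and right distributive over `+` and has no zero divisors. -/
structure IsPresemifield {E : Type*} [AddCommGroup E] (mul : E → E → E) : Prop where
  finite : Finite E
  left_distrib : ∀ x y z, mul x (y + z) = mul x y + mul x z
  right_distrib : ∀ x y z, mul (x + y) z = mul x z + mul y z
  eq_zero_or_eq_zero : ∀ x y, mul x y = 0 → x = 0 ∨ y = 0

/-- Two multiplications on `𝔽_p`-vector spaces are isotopic if there are `𝔽_p`-linear bijections
`N₁, N₂, N₃` with `N₁ (x ∘₁ y) = N₂ x ∘₂ N₃ y`. -/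
def Isotopic (p : ℕ) {E F : Type*} [AddCommGroup E] [Module (ZMod p) E]
    [AddCommGroup F] [Module (ZMod p) F] (mul₁ : E → E → E) (mul₂ : F → F → F) : Prop :=
  ∃ N₁ N₂ N₃ : E ≃ₗ[ZMod p] F, ∀ x y, N₁ (mul₁ x y) = mul₂ (N₂ x) (N₃ y)

/-- The multiplication of `S_{σ,τ,α,η}` on `L²`, the vector `(x₀, x₁)` being the pair `x`:
`(x₁ y₁^σ - η x₁^σ y₁ + α (x₀ y₀^σ - η x₀^σ y₀), x₀^τ y₁ + x₁ y₀^τ)`. -/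
def mulS {p : ℕ} {L : Type*} [Field L] [Algebra (ZMod p) L] (σ τ : L ≃ₐ[ZMod p] L) (α η : L)
    (x y : L × L) : L × L :=
  (x.2 * σ y.2 - η * σ x.2 * y.2 + α * (x.1 * σ y.1 - η * σ x.1 * y.1),
    τ x.1 * y.2 + x.2 * τ y.1)

/-- The multiplication obtained from the one on `L²` with first component
`x₁ y₁^σ - η x₁^σ y₁ + α (x₀ y₀^σ - η x₀^σ y₀)^{τ⁻¹}` and second component `x₀ y₁ + x₁ y₀`
by replacing `x₀, y₀` by `x₀^τ, y₀^τ`: the second `η` becomes `η^{τ⁻¹}`. -/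
def mulS' {p : ℕ} {L : Type*} [Field L] [Algebra (ZMod p) L] (σ τ : L ≃ₐ[ZMod p] L) (α η : L)
    (x y : L × L) : L × L :=
  (x.2 * σ y.2 - η * σ x.2 * y.2 + α * (x.1 * σ y.1 - τ.symm η * σ x.1 * y.1),
    τ x.1 * y.2 + x.2 * τ y.1)

open Sum

/-! Every bilinear map `L² × L² → L` over `𝔽_p` has a unique coefficient matrix in the Frobenius
powers of the coordinates, so it has a rank. The second component `x₀^τ y₁ + x₁ y₀^τ` of the first
product has rank two. If `v` is the second component of `N₁⁻¹`, an isotopism therefore gives `v (x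
∘₂ y)` rank at most two.

Vanishing `3 × 3` minors force `v` to have a single nonzero coefficient
(`single_coeff_of_rank_two`): the form is a twist of the second component of `∘₂` or, when `b₂ = d₂
= 0`, of the first. The rows and columns supporting it show that, up to twists, the components of
`N₂` and `N₃` are combinations of `x₀^τ` and `x₁` (`exists_substitution`).

After this substitution the two products have incompatible exponents: `false_of_substitution_inr`
and `false_of_substitution_inl` compare coefficients in the two cases. -/

/-- The powers of the Frobenius automorphism of a field `L` of order `p ^ m`, indexed by `ZMod m`:
they are linearly independent over `L` and span the `𝔽_p`-linear maps from `L` to `L`. -/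
structure FrobeniusSystem (p m : ℕ) [NeZero m] (L : Type*) [Field L] [Algebra (ZMod p) L] where
  frob : ZMod m → L →ₐ[ZMod p] L
  frob_add : ∀ i j x, frob (i + j) x = frob i (frob j x)
  frob_zero : ∀ x, frob 0 x = x
  eq_zero_of_sum : ∀ c : ZMod m → L, (∀ x, ∑ i, c i * frob i x = 0) → c = 0
  exists_coeff : ∀ f : L →ₗ[ZMod p] L, ∃ c : ZMod m → L, ∀ x, f x = ∑ i, c i * frob i x

/-! ### Linear and bilinear forms on `L²` and their coefficients -/

namespace FrobeniusSystem

variable {p m : ℕ} [NeZero m] {L : Type*} [Field L] [Algebra (ZMod p) L]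
  (Φ : FrobeniusSystem p m L)

/-- The coordinate functions `x ↦ x₀ ^ (p ^ i)` and `x ↦ x₁ ^ (p ^ i)` on `L²`. -/
def coord (i : ZMod m ⊕ ZMod m) (x : L × L) : L :=
  Sum.elim (fun i => Φ.frob i x.1) (fun i => Φ.frob i x.2) i

/-- The `𝔽_p`-linear function on `L²` with coefficients `v`. -/
def eval (v : ZMod m ⊕ ZMod m → L) (x : L × L) : L := ∑ i, v i * Φ.coord i x

theorem eval_eq (v : ZMod m ⊕ ZMod m → L) (x : L × L) :
    Φ.eval v x = ∑ i, v (inl i) * Φ.frob i x.1 + ∑ i, v (inr i) * Φ.frob i x.2 := by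
  simp [eval, coord]

theorem eq_zero_of_eval {v : ZMod m ⊕ ZMod m → L} (h : ∀ x, Φ.eval v x = 0) : v = 0 := by
  have h1 := Φ.eq_zero_of_sum (fun i => v (inl i)) fun x => by
    simpa [eval_eq] using h (x, 0)
  have h2 := Φ.eq_zero_of_sum (fun i => v (inr i)) fun x => by
    simpa [eval_eq] using h (0, x)
  funext i
  rcases i with i | i
  · exact congrFun h1 i
  · exact congrFun h2 i

theorem exists_eval (f : L × L →ₗ[ZMod p] L) :
    ∃ v : ZMod m ⊕ ZMod m → L, ∀ x, f x = Φ.eval v x := by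
  obtain ⟨c, hc⟩ := Φ.exists_coeff (f ∘ₗ LinearMap.inl _ _ _)
  obtain ⟨d, hd⟩ := Φ.exists_coeff (f ∘ₗ LinearMap.inr _ _ _)
  refine ⟨Sum.elim c d, fun x => ?_⟩
  simp only [LinearMap.comp_apply, LinearMap.inl_apply, LinearMap.inr_apply] at hc hd
  simp only [eval_eq, elim_inl, elim_inr, ← hc, ← hd, ← map_add]
  simp

/-- Independence of the Frobenius powers is used in `x` for fixed `y`, then in `y`. -/
theorem coeff_unique {M N : ZMod m ⊕ ZMod m → ZMod m ⊕ ZMod m → L}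
    (h : ∀ x y, ∑ i, ∑ j, M i j * (Φ.coord i x * Φ.coord j y) =
      ∑ i, ∑ j, N i j * (Φ.coord i x * Φ.coord j y)) (i j) : M i j = N i j := by
  have h1 : ∀ y, (fun i => Φ.eval (fun j => M i j - N i j) y) = 0 := fun y => by
    refine Φ.eq_zero_of_eval fun x => ?_
    rw [← sub_eq_zero.mpr (h x y), ← Finset.sum_sub_distrib]
    simp only [eval, ← Finset.sum_sub_distrib, Finset.sum_mul]
    exact Finset.sum_congr rfl fun i _ => Finset.sum_congr rfl fun j _ => by ring
  have h2 := Φ.eq_zero_of_eval (v := fun j => M i j - N i j) fun y => congrFun (h1 y) i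
  exact sub_eq_zero.mp (congrFun h2 j)

theorem eval_mul_eval (v w : ZMod m ⊕ ZMod m → L) (x y : L × L) :
    Φ.eval v x * Φ.eval w y = ∑ i, ∑ j, (v i * w j) * (Φ.coord i x * Φ.coord j y) := by
  simp only [eval, Finset.sum_mul_sum]
  exact Finset.sum_congr rfl fun i _ => Finset.sum_congr rfl fun j _ => by ring

/-- The coefficients of a linear function of the form `a x₀ ^ (p ^ g) + b x₁ ^ (p ^ h)`. -/
def binomial (g h : ZMod m) (a b : L) : ZMod m ⊕ ZMod m → L :=
  Sum.elim (fun i => if i = g then a else 0) (fun i => if i = h then b else 0)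

theorem eval_binomial (g h : ZMod m) (a b : L) (x : L × L) :
    Φ.eval (binomial g h a b) x = a * Φ.frob g x.1 + b * Φ.frob h x.2 := by
  simp [eval_eq, binomial]

omit [NeZero m] in
theorem eq_binomial {v : ZMod m ⊕ ZMod m → L} {g h : ZMod m}
    (hv : ∀ i, i ≠ inl g → i ≠ inr h → v i = 0) :
    v = binomial g h (v (inl g)) (v (inr h)) := by
  funext i
  rcases i with i | i
  · by_cases e : i = g
    · simp [binomial, e]
    · simpa [binomial, e] using hv (inl i) (by simpa using e) (by simp)
  · by_cases e : i = h
    · simp [binomial, e]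
    · simpa [binomial, e] using hv (inr i) (by simp) (by simpa using e)

/-- A common form of the multiplications of both families. -/
def mul (s t : ZMod m) (a b c d : L) (x y : L × L) : L × L :=
  (a * (x.2 * Φ.frob s y.2) + b * (Φ.frob s x.2 * y.2) +
    (c * (x.1 * Φ.frob s y.1) + d * (Φ.frob s x.1 * y.1)),
    Φ.frob t x.1 * y.2 + x.2 * Φ.frob t y.1)

/-- The coefficient matrix of the bilinear form `f (x ∘ y)`, where `f` has coefficients `v`. -/
def formMatrix (s t : ZMod m) (a b c d : L) (v : ZMod m ⊕ ZMod m → L) :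
    ZMod m ⊕ ZMod m → ZMod m ⊕ ZMod m → L
  | inl g, inl h => (if h = g + s then v (inl g) * Φ.frob g c else 0) +
      (if g = h + s then v (inl h) * Φ.frob h d else 0)
  | inr g, inr h => (if h = g + s then v (inl g) * Φ.frob g a else 0) +
      (if g = h + s then v (inl h) * Φ.frob h b else 0)
  | inl g, inr h => if g = h + t then v (inr h) else 0
  | inr g, inl h => if h = g + t then v (inr g) else 0

theorem eval_mul (s t : ZMod m) (a b c d : L) (v : ZMod m ⊕ ZMod m → L) (x y : L × L) :
    Φ.eval v (Φ.mul s t a b c d x y) =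
      ∑ i, ∑ j, Φ.formMatrix s t a b c d v i j * (Φ.coord i x * Φ.coord j y) := by
  have comm (f : ZMod m → ZMod m → L) : ∑ i, ∑ j, f i j = ∑ j, ∑ i, f i j := Finset.sum_comm
  have h1 (f : ZMod m → L) (e : ZMod m → ZMod m → L) (r : ZMod m) :
      ∑ g, ∑ h, (if h = g + r then f g else 0) * e g h = ∑ g, f g * e g (g + r) := by
    simp [ite_mul]
  have h2 (f : ZMod m → L) (e : ZMod m → ZMod m → L) (r : ZMod m) :
      ∑ g, ∑ h, (if g = h + r then f h else 0) * e g h = ∑ h, f h * e (h + r) h := by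
    rw [comm]
    simp [ite_mul]
  simp only [eval_eq, Fintype.sum_sum_type, formMatrix, coord, elim_inl, elim_inr, add_mul,
    Finset.sum_add_distrib, h1, h2, mul, map_add, map_mul, Φ.frob_add, mul_add]
  simp only [mul_left_comm, mul_comm]
  ring

/-- Two coefficient matrices of the same bilinear form agree, the second form being a sum of
products of linear functions. -/
theorem formMatrix_eq {s t : ZMod m} {a b c d : L} {v : ZMod m ⊕ ZMod m → L} {n : ℕ}
    {f g : Fin n → ZMod m ⊕ ZMod m → L}
    (h : ∀ x y, Φ.eval v (Φ.mul s t a b c d x y) = ∑ k, Φ.eval (f k) x * Φ.eval (g k) y) (i j) :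
    Φ.formMatrix s t a b c d v i j = ∑ k, f k i * g k j := by
  refine Φ.coeff_unique (N := fun i j => ∑ k, f k i * g k j) (fun x y => ?_) i j
  rw [← eval_mul, h]
  simp only [eval_mul_eval, Finset.sum_mul]
  rw [Finset.sum_comm]
  exact Finset.sum_congr rfl fun i _ => Finset.sum_comm

end FrobeniusSystem

/-! ### Matrices of rank at most two -/

section Rank

variable {I R : Type*} [CommRing R] {M : I → I → R} {p p' q q' : I → R}

/-- The `3 × 3` minors of a matrix of rank at most two vanish. -/
theorem det_three_eq_zero (h : ∀ i j, M i j = p i * q j + p' i * q' j) (r₁ r₂ r₃ s₁ s₂ s₃ : I) :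
    M r₁ s₁ * (M r₂ s₂ * M r₃ s₃ - M r₂ s₃ * M r₃ s₂) -
      M r₁ s₂ * (M r₂ s₁ * M r₃ s₃ - M r₂ s₃ * M r₃ s₁) +
      M r₁ s₃ * (M r₂ s₁ * M r₃ s₂ - M r₂ s₂ * M r₃ s₁) = 0 := by
  simp only [h]; ring

/-- In a factorization of a matrix of rank two, the left factors vanish on the zero rows. -/
theorem left_factors_eq_zero [IsDomain R] (h : ∀ i j, M i j = p i * q j + p' i * q' j) {r₁ r₂ s₁ s₂ i : I}
    (hM : M r₁ s₁ * M r₂ s₂ - M r₁ s₂ * M r₂ s₁ ≠ 0) (h₁ : M i s₁ = 0) (h₂ : M i s₂ = 0) :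
    p i = 0 ∧ p' i = 0 := by
  have e : M r₁ s₁ * M r₂ s₂ - M r₁ s₂ * M r₂ s₁ =
      (p r₁ * p' r₂ - p' r₁ * p r₂) * (q s₁ * q' s₂ - q' s₁ * q s₂) := by
    simp only [h]; ring
  have hq : q s₁ * q' s₂ - q' s₁ * q s₂ ≠ 0 := right_ne_zero_of_mul (e ▸ hM)
  rw [h] at h₁ h₂
  constructor
  · refine (mul_eq_zero.mp ?_).resolve_right hq
    linear_combination q' s₂ * h₁ - q' s₁ * h₂
  · refine (mul_eq_zero.mp ?_).resolve_right hq
    linear_combination q s₁ * h₂ - q s₂ * h₁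

theorem det_left_factors_ne_zero (h : ∀ i j, M i j = p i * q j + p' i * q' j) {r₁ r₂ s₁ s₂ : I}
    (hM : M r₁ s₁ * M r₂ s₂ - M r₁ s₂ * M r₂ s₁ ≠ 0) :
    p r₁ * p' r₂ - p r₂ * p' r₁ ≠ 0 := by
  have e : M r₁ s₁ * M r₂ s₂ - M r₁ s₂ * M r₂ s₁ =
      (p r₁ * p' r₂ - p r₂ * p' r₁) * (q s₁ * q' s₂ - q' s₁ * q s₂) := by
    simp only [h]; ring
  exact left_ne_zero_of_mul (e ▸ hM)

end Rank

/-! ### Classification of the forms of rank at most two -/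

namespace FrobeniusSystem

variable {p m : ℕ} [NeZero m] {L : Type*} [Field L] [Algebra (ZMod p) L]
  (Φ : FrobeniusSystem p m L)

variable {s t : ZMod m} {a b c d : L} {v q q' r r' : ZMod m ⊕ ZMod m → L}

/-- The chosen minor is diagonal: its entries are `v (inl g)` times Frobenius images of `a`, `b`,
`c`. -/
theorem inl_coeff_eq_zero_of_rank_two
    (h : ∀ i j, Φ.formMatrix t s a b c d v i j = q i * r j + q' i * r' j)
    (hs : s ≠ 0) (hst : s ≠ t) (hst' : s + t ≠ 0) (ht : t ≠ 0) (ht2 : t + t ≠ 0)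
    (ha : a ≠ 0) (hb : b ≠ 0) (hc : c ≠ 0) (g : ZMod m) : v (inl g) = 0 := by
  have D := det_three_eq_zero h (inr g) (inr (g + t)) (inl g) (inr (g + t)) (inr g) (inl (g + t))
  have hst'' : t + s ≠ 0 := by rwa [add_comm]
  simpa [formMatrix, add_assoc, hs, hst, hst.symm, hst'', ht, ht2, ha, hb, hc] using D

/-- For two nonzero coefficients, a minor is triangular with nonzero diagonal unless `g + t = g' +
s`. Exchanging `g` and `g'` and adding gives `2s = 2t`. -/
theorem inl_coeff_unique_of_rank_two
    (h : ∀ i j, Φ.formMatrix t s a 0 c 0 v i j = q i * r j + q' i * r' j)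
    (hst : s ≠ t) (hst' : s + t ≠ 0) (hst2 : s + s ≠ t + t)
    (ha : a ≠ 0) (hc : c ≠ 0) {g g' : ZMod m} (hg : v (inl g) ≠ 0) (hg' : v (inl g') ≠ 0) :
    g = g' := by
  by_contra hne
  have hst'' : t + s ≠ 0 := by rwa [add_comm]
  have key : ∀ g g', v (inl g) ≠ 0 → v (inl g') ≠ 0 → g ≠ g' → g + t = g' + s := by
    intro g g' hg hg' hne
    by_contra hgs
    have D := det_three_eq_zero h (inr g) (inr g') (inl g) (inr (g + t)) (inr (g' + t))
      (inl (g + t))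
    simp [formMatrix, add_assoc, hst.symm, hst'', ha, hc, hg, hg', hne.symm, hgs] at D
  have e1 := key g g' hg hg' hne
  have e2 := key g' g hg' hg (Ne.symm hne)
  refine hst2 ?_
  linear_combination -e1 - e2

/-- If both coefficients are nonzero, some minor reduces to a single nonzero product. Which minor
works depends on the coincidences `g' = g`, `t = 0` and `g + t = g' + s`. -/
theorem inr_coeff_eq_zero_of_rank_two
    (h : ∀ i j, Φ.formMatrix t s a 0 c 0 v i j = q i * r j + q' i * r' j)
    (hs : s ≠ 0) (hst : s ≠ t) (hst' : s + t ≠ 0) (hst2 : s + s ≠ t + t)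
    (ha : a ≠ 0) (hc : c ≠ 0) {g : ZMod m} (hg : v (inl g) ≠ 0) (g' : ZMod m) :
    v (inr g') = 0 := by
  by_contra hv
  have hst'' : t + s ≠ 0 := by rwa [add_comm]
  have hu : ∀ j, j ≠ g → v (inl j) = 0 := fun j hj => by
    by_contra h0
    exact hj (Φ.inl_coeff_unique_of_rank_two h hst hst' hst2 ha hc h0 hg)
  by_cases e1 : g' = g
  · subst e1
    by_cases e2 : t = 0
    · have D := det_three_eq_zero h (inr g') (inl g') (inl (g' + s)) (inr g') (inl g')
        (inl (g' + s))
      simp [formMatrix, e2, hs, hc, hg, hv, hu (g' + s) (by simpa using hs)] at D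
    · have D := det_three_eq_zero h (inr g') (inl g') (inl (g' + s)) (inr (g' + t)) (inl (g' + t))
        (inr g')
      simp [formMatrix, add_assoc, e2, hs, hst.symm, ha, hc, hg, hv, add_left_comm] at D
  have e1' : g ≠ g' := Ne.symm e1
  by_cases e3 : g + t = g' + s
  · have e4 : g' ≠ g + t := fun e => hs (by simpa [e3] using e)
    by_cases e2 : t = 0
    · have D := det_three_eq_zero h (inr g) (inl g) (inr g') (inr g) (inl g) (inr g')
      subst e2
      rw [add_zero] at e3 e4
      simp [formMatrix, hs, hu g' e1, ha, hg, hv, e1, e1', ← e3] at D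
    · have e5 : g ≠ g' + s := fun e => e2 (by simpa [← e3] using e)
      have D := det_three_eq_zero h (inr g) (inl g) (inl (g + t)) (inr (g + t)) (inl (g + t))
        (inr g')
      simp [formMatrix, add_assoc, hs, ha, hc, hg, hv, e1, e2, e3, e5] at D
  · have e4 : g' + s ≠ g + t := Ne.symm e3
    have D := det_three_eq_zero h (inr g) (inl g) (inr g') (inr (g + t)) (inl (g + t))
      (inl (g' + s))
    simp [formMatrix, add_assoc, hst.symm, hst'', ha, hc, hg, hv, e1, e1', e3, e4] at D

/-- Each nonzero coefficient contributes two entries, at transposed positions, alone in their rows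
and columns; two coefficients would give rank four. -/
theorem inr_coeff_unique_of_rank_two
    (h : ∀ i j, Φ.formMatrix t s a b c d v i j = q i * r j + q' i * r' j)
    (hv : ∀ g, v (inl g) = 0) {g g' : ZMod m} (hg : v (inr g) ≠ 0) (hg' : v (inr g') ≠ 0) :
    g = g' := by
  by_contra hne
  have D := det_three_eq_zero h (inr g) (inr g') (inl (g + s)) (inl (g + s)) (inl (g' + s)) (inr g)
  simp [formMatrix, hv, hg, hg', hne, Ne.symm hne] at D

/-- The nonzero forms of rank at most two are supported on a single coefficient. -/
theorem single_coeff_of_rank_two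
    (h : ∀ i j, Φ.formMatrix t s a b c d v i j = q i * r j + q' i * r' j) (hv : v ≠ 0)
    (hs : s ≠ 0) (hst : s ≠ t) (hst' : s + t ≠ 0) (hst2 : s + s ≠ t + t)
    (ha : a ≠ 0) (hc : c ≠ 0)
    (hbd : (b = 0 ∧ d = 0) ∨ (b ≠ 0 ∧ t ≠ 0 ∧ t + t ≠ 0)) :
    (∃ g, v (inr g) ≠ 0 ∧ (∀ i, v (inl i) = 0) ∧ ∀ i, i ≠ g → v (inr i) = 0) ∨
    ((b = 0 ∧ d = 0) ∧
      ∃ g, v (inl g) ≠ 0 ∧ (∀ i, v (inr i) = 0) ∧ ∀ i, i ≠ g → v (inl i) = 0) := by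
  by_cases h0 : ∀ i, v (inl i) = 0
  · left
    have : ∃ g, v (inr g) ≠ 0 := by
      by_contra! h1
      exact hv (funext fun i => by rcases i with i | i <;> simp [h0, h1])
    obtain ⟨g, hg⟩ := this
    refine ⟨g, hg, h0, fun i hi => ?_⟩
    by_contra h1
    exact hi (Φ.inr_coeff_unique_of_rank_two h h0 h1 hg)
  · right
    push Not at h0
    obtain ⟨g, hg⟩ := h0
    rcases hbd with ⟨rfl, rfl⟩ | ⟨hb, ht, ht2⟩
    · refine ⟨⟨rfl, rfl⟩, g, hg,
        Φ.inr_coeff_eq_zero_of_rank_two h hs hst hst' hst2 ha hc hg, fun i hi => ?_⟩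
      by_contra h1
      exact hi (Φ.inl_coeff_unique_of_rank_two h hst hst' hst2 ha hc h1 hg)
    · exact absurd (Φ.inl_coeff_eq_zero_of_rank_two h hs hst hst' ht ht2 ha hb hc g) hg

/-! ### Substituting the two-term forms of `N₂` and `N₃` -/

theorem frob_eval_binomial (s g h : ZMod m) (a b : L) (x : L × L) :
    Φ.frob s (Φ.eval (binomial g h a b) x) =
      Φ.eval (binomial (s + g) (s + h) (Φ.frob s a) (Φ.frob s b)) x := by
  simp only [eval_binomial, map_add, map_mul, Φ.frob_add]

theorem eval_smul (k : L) (v : ZMod m ⊕ ZMod m → L) (x : L × L) :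
    Φ.eval (k • v) x = k * Φ.eval v x := by
  simp only [eval, Pi.smul_apply, smul_eq_mul, Finset.mul_sum, mul_assoc]

theorem eval_coeff_linearEquiv_ne_zero {N : (L × L) ≃ₗ[ZMod p] (L × L)}
    {v : ZMod m ⊕ ZMod m → L} (hv : ∀ u, (N u).2 = Φ.eval v u) : v ≠ 0 := by
  rintro rfl
  have := hv (N.symm (0, 1))
  simp [eval] at this

/-- If the components of `N⁻¹`, the first one twisted, depend on two coordinates only,
then so do the twisted components of `N`. -/
theorem exists_substitution {t g₁ g₂ : ZMod m} {N : (L × L) ≃ₗ[ZMod p] (L × L)}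
    {q q' : ZMod m ⊕ ZMod m → L}
    (hq : ∀ u, Φ.frob t (N.symm u).1 = Φ.eval q u) (hq' : ∀ u, (N.symm u).2 = Φ.eval q' u)
    (h0 : ∀ i, i ≠ inl g₁ → i ≠ inr g₂ → q i = 0 ∧ q' i = 0)
    (hdet : q (inl g₁) * q' (inr g₂) - q (inr g₂) * q' (inl g₁) ≠ 0) :
    ∃ a b c d : L, a * d - b * c ≠ 0 ∧
      (∀ x, Φ.frob g₁ (N x).1 = Φ.eval (binomial t 0 a b) x) ∧
      ∀ x, Φ.frob g₂ (N x).2 = Φ.eval (binomial t 0 c d) x := by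
  rw [eq_binomial fun i h h' => (h0 i h h').1] at hq
  rw [eq_binomial fun i h h' => (h0 i h h').2] at hq'
  generalize q (inl g₁) = a, q (inr g₂) = b, q' (inl g₁) = c, q' (inr g₂) = d at *
  have h1 x := hq (N x)
  have h2 x := hq' (N x)
  simp only [eval_binomial, LinearEquiv.symm_apply_apply] at h1 h2
  -- These are the entries of the inverse of the `2 × 2` matrix of `N⁻¹`.
  refine ⟨d / (a * d - b * c), -b / (a * d - b * c), -c / (a * d - b * c), a / (a * d - b * c),
    ?_, fun x => ?_, fun x => ?_⟩
  · have : d / (a * d - b * c) * (a / (a * d - b * c)) -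
        -b / (a * d - b * c) * (-c / (a * d - b * c)) = 1 / (a * d - b * c) := by
      field_simp
    rw [this]
    exact one_div_ne_zero hdet
  · rw [eval_binomial, h1 x, frob_zero, h2 x]
    linear_combination -Φ.frob g₁ (N x).1 * mul_inv_cancel₀ hdet
  · rw [eval_binomial, h1 x, frob_zero, h2 x]
    linear_combination -Φ.frob g₂ (N x).2 * mul_inv_cancel₀ hdet

variable {s t g : ZMod m} {a b c d a₁ b₁ c₁ d₁ a₂ b₂ c₂ d₂ a' b' c' d' : L}
  {N₁ N₂ N₃ : (L × L) ≃ₗ[ZMod p] (L × L)}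

/-- This is the case of a twisted second component. In a form of the first product, like coordinates
occur only with exponents differing by `±s`, so entries with difference `t` or `0` vanish. -/
theorem false_of_substitution_inr
    (hN : ∀ x y, N₁ (Φ.mul s t a₁ b₁ c₁ d₁ x y) = Φ.mul t s a₂ b₂ c₂ d₂ (N₂ x) (N₃ y))
    (hs : s ≠ 0) (hst : s ≠ t) (hst' : s + t ≠ 0)
    (ha : a₂ ≠ 0) (hc : c₂ ≠ 0)
    (hbd : (b₂ = 0 ∧ d₂ = 0) ∨ (b₂ ≠ 0 ∧ t ≠ 0 ∧ t + t ≠ 0))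
    (hdet : a * d - b * c ≠ 0) (hdet' : a' * d' - b' * c' ≠ 0)
    (h1 : ∀ x, Φ.frob (g + s) (N₂ x).1 = Φ.eval (binomial t 0 a b) x)
    (h2 : ∀ x, Φ.frob g (N₂ x).2 = Φ.eval (binomial t 0 c d) x)
    (h3 : ∀ x, Φ.frob (g + s) (N₃ x).1 = Φ.eval (binomial t 0 a' b') x)
    (h4 : ∀ x, Φ.frob g (N₃ x).2 = Φ.eval (binomial t 0 c' d') x) : False := by
  have hst'' : t + s ≠ 0 := by rwa [add_comm]
  have hgs u : Φ.frob s (Φ.frob g u) = Φ.frob (g + s) u := by rw [← frob_add, add_comm]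
  have hgt u : Φ.frob t (Φ.frob (g + s) u) = Φ.frob (g + s) (Φ.frob t u) := by
    rw [← frob_add, ← frob_add, add_comm]
  obtain ⟨v, hv⟩ := Φ.exists_eval ((Φ.frob (g + s)).toLinearMap ∘ₗ LinearMap.fst _ _ _ ∘ₗ
    N₁.toLinearMap)
  obtain ⟨w, hw⟩ := Φ.exists_eval ((Φ.frob g).toLinearMap ∘ₗ LinearMap.snd _ _ _ ∘ₗ
    N₁.toLinearMap)
  have e1 := Φ.formMatrix_eq (v := v) (s := s) (t := t) (a := a₁) (b := b₁) (c := c₁) (d := d₁)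
    (f := ![Φ.frob (g + s) a₂ • binomial (s + t) (s + 0) (Φ.frob s c) (Φ.frob s d),
      Φ.frob (g + s) b₂ • binomial (t + (s + t)) (t + (s + 0)) (Φ.frob t (Φ.frob s c))
        (Φ.frob t (Φ.frob s d)),
      Φ.frob (g + s) c₂ • binomial t 0 a b,
      Φ.frob (g + s) d₂ • binomial (t + t) (t + 0) (Φ.frob t a) (Φ.frob t b)])
    (g := ![binomial (t + (s + t)) (t + (s + 0)) (Φ.frob t (Φ.frob s c')) (Φ.frob t (Φ.frob s d')),
      binomial (s + t) (s + 0) (Φ.frob s c') (Φ.frob s d'),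
      binomial (t + t) (t + 0) (Φ.frob t a') (Φ.frob t b'),
      binomial t 0 a' b']) (fun x y => by
      rw [← hv]
      change Φ.frob (g + s) (N₁ _).1 = _
      rw [hN]
      simp only [Fin.sum_univ_four, mul, Matrix.cons_val, map_add, map_mul,
        eval_smul, ← frob_eval_binomial, ← h1, ← h2, ← h3, ← h4, hgs, hgt]
      ring)
  have e2 := Φ.formMatrix_eq (v := w) (s := s) (t := t) (a := a₁) (b := b₁) (c := c₁) (d := d₁)
    (f := ![binomial t 0 a b, binomial t 0 c d])
    (g := ![binomial t 0 c' d', binomial t 0 a' b']) (fun x y => by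
      rw [← hw]
      change Φ.frob g (N₁ _).2 = _
      rw [hN]
      simp only [Fin.sum_univ_two, mul, Matrix.cons_val, map_add, map_mul,
        ← h1, ← h2, ← h3, ← h4, frob_add])
  have n1 := hst.symm
  have n2 : 0 ≠ t + s := hst''.symm
  have n3 : t ≠ t + t + s := fun e => hst' (by linear_combination -e)
  have n4 : t + (s + t) ≠ s + t + s := fun e => hst (by linear_combination -e)
  have n5 : s + t ≠ t + (s + t) + s := fun e => hst' (by linear_combination -e)
  have hbb : b = 0 ∨ b' = 0 := by
    have := e1 (inr 0) (inr t)
    rcases hbd with ⟨rfl, rfl⟩ | ⟨-, ht, ht2⟩ <;>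
    simpa [formMatrix, binomial, Fin.sum_univ_four, *] using this.symm
  have haa : a = 0 ∨ a' = 0 := by
    have := e1 (inl t) (inl (t + t))
    rcases hbd with ⟨rfl, rfl⟩ | ⟨-, ht, ht2⟩ <;>
    simpa [formMatrix, binomial, Fin.sum_univ_four, *] using this.symm
  have hcc : c = 0 ∨ c' = 0 := by
    have := e1 (inl (s + t)) (inl (t + (s + t)))
    rcases hbd with ⟨rfl, rfl⟩ | ⟨-, ht, ht2⟩ <;>
    simpa [formMatrix, binomial, Fin.sum_univ_four, *] using this.symm
  have hdd : d = 0 ∨ d' = 0 := by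
    have := e1 (inr s) (inr (t + s))
    rcases hbd with ⟨rfl, rfl⟩ | ⟨-, ht, ht2⟩ <;>
    simpa [formMatrix, binomial, Fin.sum_univ_four, *] using this.symm
  have h5 : a * c' + c * a' = 0 := by
    have := e2 (inl t) (inl t)
    simpa [formMatrix, binomial, hs] using this.symm
  have h6 : b * d' + d * b' = 0 := by
    have := e2 (inr 0) (inr 0)
    simpa [formMatrix, binomial, hs, hs.symm] using this.symm
  -- If `a = 0`, then `c ≠ 0`, hence `c' = 0`, and `h5` gives `a' = 0`, against `hdet'`; the case
  -- `a' = 0` is symmetric.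
  grind

/-- This is the case of a twisted first component, whose columns are shifted by `t` from its rows;
hence the extra twist of `N₃`. The second component of `N₁` suffices for the contradiction. -/
theorem false_of_substitution_inl
    (hN : ∀ x y, N₁ (Φ.mul s t a₁ b₁ c₁ d₁ x y) = Φ.mul t s a₂ b₂ c₂ d₂ (N₂ x) (N₃ y))
    (hs : s ≠ 0) (hs2 : s + s ≠ 0) (hst : s ≠ t) (hst' : s + t ≠ 0) (ht : t = 0 ∨ t + t ≠ 0)
    (ha : a₁ ≠ 0) (hc : c₁ ≠ 0)
    (hdet : a * d - b * c ≠ 0) (hdet' : a' * d' - b' * c' ≠ 0)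
    (h1 : ∀ x, Φ.frob g (N₂ x).1 = Φ.eval (binomial t 0 a b) x)
    (h2 : ∀ x, Φ.frob g (N₂ x).2 = Φ.eval (binomial t 0 c d) x)
    (h3 : ∀ x, Φ.frob (g + t) (N₃ x).1 = Φ.eval (binomial t 0 a' b') x)
    (h4 : ∀ x, Φ.frob (g + t) (N₃ x).2 = Φ.eval (binomial t 0 c' d') x) : False := by
  obtain ⟨v, hv⟩ := Φ.exists_eval ((Φ.frob (g + t)).toLinearMap ∘ₗ LinearMap.snd _ _ _ ∘ₗ
    N₁.toLinearMap)
  have e := Φ.formMatrix_eq (v := v) (s := s) (t := t) (a := a₁) (b := b₁) (c := c₁) (d := d₁)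
    (f := ![binomial (s + t + t) (s + t + 0) (Φ.frob (s + t) a) (Φ.frob (s + t) b),
      binomial (t + t) (t + 0) (Φ.frob t c) (Φ.frob t d)])
    (g := ![binomial t 0 c' d', binomial (s + t) (s + 0) (Φ.frob s a') (Φ.frob s b')])
    (fun x y => by
      rw [← hv]
      change Φ.frob (g + t) (N₁ _).2 = _
      rw [hN]
      simp only [Fin.sum_univ_two, mul, Matrix.cons_val, map_add, map_mul, ← frob_eval_binomial,
        ← h1, ← h2, ← h3, ← h4, ← frob_add]
      rw [add_comm t g, add_comm s (g + t), add_right_comm s t g, add_comm s g, add_right_comm g s t])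
  have m1 : s + t + t ≠ t := fun h => hst' (by linear_combination h)
  have had : a = 0 ∨ d' = 0 := by
    have := e (inl (s + t + t)) (inr 0)
    simpa [formMatrix, binomial, hs, hs.symm, hst, hst', m1] using this.symm
  have hcb : c = 0 ∨ b' = 0 := by
    have := e (inl (t + t)) (inr s)
    simpa [formMatrix, binomial, hs, hs.symm, hst, hst.symm, hst', m1] using this.symm
  have hbc : b = 0 ∨ c' = 0 := by
    have := e (inr (s + t)) (inl t)
    simpa [formMatrix, binomial, hs, hs.symm, hst, hst', m1, m1.symm] using this.symm
  have hda : d = 0 ∨ a' = 0 := by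
    have := e (inr t) (inl (s + t))
    simpa [formMatrix, binomial, hs, hs.symm, hst, hst', m1] using this.symm
  -- One of the two substitution matrices is diagonal and the other antidiagonal.
  have hcases : (a = 0 ∧ d = 0 ∧ b ≠ 0 ∧ c ≠ 0 ∧ b' = 0 ∧ c' = 0 ∧ a' ≠ 0 ∧ d' ≠ 0) ∨
      (b = 0 ∧ c = 0 ∧ a ≠ 0 ∧ d ≠ 0 ∧ a' = 0 ∧ d' = 0 ∧ b' ≠ 0 ∧ c' ≠ 0) := by
    by_cases ha0 : a = 0
    · have hb : b ≠ 0 := fun h => hdet (by simp [h, ha0])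
      have hc' : c ≠ 0 := fun h => hdet (by simp [h, ha0])
      have hb0 := hcb.resolve_left hc'
      have hc0 := hbc.resolve_left hb
      have ha' : a' ≠ 0 := fun h => hdet' (by simp [h, hb0])
      have hd' : d' ≠ 0 := fun h => hdet' (by simp [h, hb0])
      exact Or.inl ⟨ha0, hda.resolve_right ha', hb, hc', hb0, hc0, ha', hd'⟩
    · have hd0 := had.resolve_left ha0
      have hb' : b' ≠ 0 := fun h => hdet' (by simp [h, hd0])
      have hc' : c' ≠ 0 := fun h => hdet' (by simp [h, hd0])
      have hb0 := hbc.resolve_right hc'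
      have hd : d ≠ 0 := fun h => hdet (by simp [h, hb0])
      exact Or.inr ⟨hb0, hcb.resolve_right hb', ha0, hd, hda.resolve_left hd, hd0, hb', hc'⟩
  rcases hcases with ⟨rfl, rfl, hb, hc', rfl, rfl, ha', hd'⟩ | ⟨rfl, rfl, ha', hd, rfl, rfl, hb', hc'⟩
  · have E1 := e (inl (t + t)) (inl (s + t))
    have E2 := e (inr (s + t)) (inr 0)
    have E3 := e (inr 0) (inr s)
    -- For `t = 0`, `E3` makes `v (inl 0)` vanish while `E1` forbids it. Otherwise the nonzero
    -- entries in `E1` and `E2` must have exponent difference `±s`, so `t = 2s` and `t = -2s`,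
    -- whence `2t = 0`.
    rcases eq_or_ne t 0 with rfl | ht0
    · simp [formMatrix, binomial, hs, hs.symm, hs2.symm, ha] at E1 E3
      simp [E3, hc', ha'] at E1
    · have ht2 := ht.resolve_left ht0
      have k1 : t + t = s + t + s := by
        by_contra k
        have : s + t ≠ t + t + s := fun h => ht0 (by linear_combination -h)
        simp [formMatrix, binomial, this, k, hc', ha'] at E1
      have k2 : 0 = s + t + s := by
        by_contra k
        simp [formMatrix, binomial, k, ht0, hb, hd'] at E2
      exact ht2 (k1.trans k2.symm)
  · have E1 := e (inl (s + t + t)) (inl t)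
    have E2 := e (inr t) (inr s)
    have E3 := e (inl 0) (inl s)
    rcases eq_or_ne t 0 with rfl | ht0
    · simp [formMatrix, binomial, hs, hs.symm, hs2.symm, hc] at E1 E3
      simp [E3, hc', ha'] at E1
    · have ht2 := ht.resolve_left ht0
      have k1 : t = s + t + t + s := by
        by_contra k
        have : s + t + t ≠ t + s := fun h => ht0 (by linear_combination h)
        simp [formMatrix, binomial, this, k, hc', ha'] at E1
      have k2 : t = s + s := by
        by_contra k
        simp [formMatrix, binomial, k, ht0, hd, hb'] at E2
      exact ht2 (by linear_combination k2 - k1)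

theorem not_isotopic_mul
    (hs : s ≠ 0) (hs2 : s + s ≠ 0) (hst : s ≠ t) (hst' : s + t ≠ 0) (hst2 : s + s ≠ t + t)
    (ht : t = 0 ∨ t + t ≠ 0) (ha₁ : a₁ ≠ 0) (hc₁ : c₁ ≠ 0) (ha₂ : a₂ ≠ 0) (hc₂ : c₂ ≠ 0)
    (hbd : (b₂ = 0 ∧ d₂ = 0) ∨ (b₂ ≠ 0 ∧ t ≠ 0)) :
    ¬ Isotopic p (Φ.mul s t a₁ b₁ c₁ d₁) (Φ.mul t s a₂ b₂ c₂ d₂) := by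
  rintro ⟨N₁, N₂, N₃, hN⟩
  have hbd' : (b₂ = 0 ∧ d₂ = 0) ∨ (b₂ ≠ 0 ∧ t ≠ 0 ∧ t + t ≠ 0) :=
    hbd.imp_right fun h => ⟨h.1, h.2, ht.resolve_left h.2⟩
  obtain ⟨v, hv⟩ := Φ.exists_eval (LinearMap.snd _ _ _ ∘ₗ N₁.symm.toLinearMap)
  obtain ⟨q, hq⟩ := Φ.exists_eval ((Φ.frob t).toLinearMap ∘ₗ LinearMap.fst _ _ _ ∘ₗ
    N₂.symm.toLinearMap)
  obtain ⟨q', hq'⟩ := Φ.exists_eval (LinearMap.snd _ _ _ ∘ₗ N₂.symm.toLinearMap)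
  obtain ⟨r, hr⟩ := Φ.exists_eval ((Φ.frob t).toLinearMap ∘ₗ LinearMap.fst _ _ _ ∘ₗ
    N₃.symm.toLinearMap)
  obtain ⟨r', hr'⟩ := Φ.exists_eval (LinearMap.snd _ _ _ ∘ₗ N₃.symm.toLinearMap)
  have hv0 : v ≠ 0 := Φ.eval_coeff_linearEquiv_ne_zero (N := N₁.symm) hv
  have hM i j : Φ.formMatrix t s a₂ b₂ c₂ d₂ v i j = q i * r' j + q' i * r j := by
    have := Φ.formMatrix_eq (v := v) (s := t) (t := s) (a := a₂) (b := b₂) (c := c₂) (d := d₂)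
      (f := ![q, q']) (g := ![r', r]) (fun x y => by
        rw [← hv]
        have := hN (N₂.symm x) (N₃.symm y)
        rw [LinearEquiv.apply_symm_apply, LinearEquiv.apply_symm_apply,
          ← LinearEquiv.eq_symm_apply] at this
        change (N₁.symm _).2 = _
        rw [← this]
        simp only [Fin.sum_univ_two, Matrix.cons_val, ← hq, ← hq', ← hr, ← hr']
        rfl) i j
    simpa using this
  -- Transposing turns the right factors, which describe `N₃⁻¹`, into left factors.
  have hM' j i : Φ.formMatrix t s a₂ b₂ c₂ d₂ v i j = r j * q' i + r' j * q i := by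
    rw [hM]; ring
  rcases Φ.single_coeff_of_rank_two hM hv0 hs hst hst' hst2 ha₂ hc₂ hbd' with
    ⟨g, hg, hl, hr0⟩ | ⟨⟨rfl, rfl⟩, g, hg, hr0, hl⟩
  · have hrow (i) (h : i ≠ inl (g + s)) (h' : i ≠ inr g) (j) :
        Φ.formMatrix t s a₂ b₂ c₂ d₂ v i j = 0 ∧ Φ.formMatrix t s a₂ b₂ c₂ d₂ v j i = 0 := by
      rcases i with i | i <;> rcases j with j | j <;> simp [formMatrix, hl]
      · have : i ≠ g + s := by simpa using h
        rintro rfl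
        exact hr0 _ fun e => this (by rw [e])
      · have : i ≠ g := by simpa using h'
        exact fun _ => hr0 _ this
    have hminor : Φ.formMatrix t s a₂ b₂ c₂ d₂ v (inl (g + s)) (inr g) *
        Φ.formMatrix t s a₂ b₂ c₂ d₂ v (inr g) (inl (g + s)) -
        Φ.formMatrix t s a₂ b₂ c₂ d₂ v (inl (g + s)) (inl (g + s)) *
        Φ.formMatrix t s a₂ b₂ c₂ d₂ v (inr g) (inr g) ≠ 0 := by
      simp [formMatrix, hl, hg]
    have hminor' : Φ.formMatrix t s a₂ b₂ c₂ d₂ v (inr g) (inl (g + s)) *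
        Φ.formMatrix t s a₂ b₂ c₂ d₂ v (inl (g + s)) (inr g) -
        Φ.formMatrix t s a₂ b₂ c₂ d₂ v (inl (g + s)) (inl (g + s)) *
        Φ.formMatrix t s a₂ b₂ c₂ d₂ v (inr g) (inr g) ≠ 0 := by
      simp [formMatrix, hl, hg]
    obtain ⟨a, b, c, d, hdet, h1, h2⟩ := Φ.exists_substitution (g₁ := g + s) (g₂ := g) hq hq'
      (fun i h h' => left_factors_eq_zero hM hminor (hrow i h h' _).1 (hrow i h h' _).1)
      (det_left_factors_ne_zero hM hminor)
    obtain ⟨a', b', c', d', hdet', h3, h4⟩ := Φ.exists_substitution (g₁ := g + s) (g₂ := g) hr hr'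
      (fun i h h' => left_factors_eq_zero (M := fun j i => Φ.formMatrix t s a₂ b₂ c₂ d₂ v i j)
        hM' hminor' (hrow i h h' _).2 (hrow i h h' _).2)
      (det_left_factors_ne_zero (M := fun j i => Φ.formMatrix t s a₂ b₂ c₂ d₂ v i j) hM' hminor')
    exact Φ.false_of_substitution_inr hN hs hst hst' ha₂ hc₂ hbd' hdet hdet' h1 h2 h3 h4
  · have hrow (i) (h : i ≠ inl g) (h' : i ≠ inr g) (j) :
        Φ.formMatrix t s a₂ 0 c₂ 0 v i j = 0 := by
      rcases i with i | i <;> rcases j with j | j <;> simp [formMatrix, hr0]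
      · exact fun _ => Or.inl (hl _ (by simpa using h))
      · exact fun _ => Or.inl (hl _ (by simpa using h'))
    have hcol (i) (h : i ≠ inl (g + t)) (h' : i ≠ inr (g + t)) (j) :
        Φ.formMatrix t s a₂ 0 c₂ 0 v j i = 0 := by
      rcases i with i | i <;> rcases j with j | j <;> simp [formMatrix, hr0]
      · rintro rfl
        exact Or.inl (hl _ fun e => h (by rw [e]))
      · rintro rfl
        exact Or.inl (hl _ fun e => h' (by rw [e]))
    have hminor : Φ.formMatrix t s a₂ 0 c₂ 0 v (inl g) (inl (g + t)) *
        Φ.formMatrix t s a₂ 0 c₂ 0 v (inr g) (inr (g + t)) -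
        Φ.formMatrix t s a₂ 0 c₂ 0 v (inl g) (inr (g + t)) *
        Φ.formMatrix t s a₂ 0 c₂ 0 v (inr g) (inl (g + t)) ≠ 0 := by
      simp [formMatrix, hr0, hg, ha₂, hc₂]
    have hminor' : Φ.formMatrix t s a₂ 0 c₂ 0 v (inl g) (inl (g + t)) *
        Φ.formMatrix t s a₂ 0 c₂ 0 v (inr g) (inr (g + t)) -
        Φ.formMatrix t s a₂ 0 c₂ 0 v (inr g) (inl (g + t)) *
        Φ.formMatrix t s a₂ 0 c₂ 0 v (inl g) (inr (g + t)) ≠ 0 := by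
      simp [formMatrix, hr0, hg, ha₂, hc₂]
    obtain ⟨a, b, c, d, hdet, h1, h2⟩ := Φ.exists_substitution (g₁ := g) (g₂ := g) hq hq'
      (fun i h h' => left_factors_eq_zero hM hminor (hrow i h h' _) (hrow i h h' _))
      (det_left_factors_ne_zero hM hminor)
    obtain ⟨a', b', c', d', hdet', h3, h4⟩ := Φ.exists_substitution (g₁ := g + t) (g₂ := g + t)
      hr hr'
      (fun i h h' => left_factors_eq_zero (M := fun j i => Φ.formMatrix t s a₂ 0 c₂ 0 v i j)
        hM' hminor' (hcol i h h' _) (hcol i h h' _))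
      (det_left_factors_ne_zero (M := fun j i => Φ.formMatrix t s a₂ 0 c₂ 0 v i j) hM' hminor')
    exact Φ.false_of_substitution_inl hN hs hs2 hst hst' ht ha₁ hc₁ hdet hdet' h1 h2 h3 h4

end FrobeniusSystem

/-! ### Frobenius powers of a finite field -/

theorem isotopic_symm {p : ℕ} {E F : Type*} [AddCommGroup E] [Module (ZMod p) E]
    [AddCommGroup F] [Module (ZMod p) F] {mul₁ : E → E → E} {mul₂ : F → F → F}
    (h : Isotopic p mul₁ mul₂) : Isotopic p mul₂ mul₁ := by
  obtain ⟨N₁, N₂, N₃, h⟩ := h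
  refine ⟨N₁.symm, N₂.symm, N₃.symm, fun x y => ?_⟩
  rw [LinearEquiv.symm_apply_eq, h, LinearEquiv.apply_symm_apply, LinearEquiv.apply_symm_apply]

theorem exists_frobeniusSystem {p m : ℕ} [Fact p.Prime] [NeZero m] {L : Type*} [Field L]
    [Algebra (ZMod p) L] (hL : Nat.card L = p ^ m) :
    ∃ Φ : FrobeniusSystem p m L, ∀ (n : ℕ) (x : L), Φ.frob n x = x ^ p ^ n := by
  have hp : p.Prime := Fact.out
  have : Finite L := Nat.finite_of_card_ne_zero (hL ▸ pow_ne_zero _ hp.ne_zero)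
  have := Fintype.ofFinite L
  have hrank : Module.finrank (ZMod p) L = m := by
    have := Module.card_eq_pow_finrank (K := ZMod p) (V := L)
    rw [← Nat.card_eq_fintype_card, hL, ZMod.card] at this
    exact (Nat.pow_right_injective hp.two_le this).symm
  have hord := FiniteField.orderOf_frobeniusAlgHom (ZMod p) L
  rw [hrank] at hord
  set F := FiniteField.frobeniusAlgHom (ZMod p) L with hF
  have hpow (n : ℕ) (x : L) : (F ^ n) x = x ^ p ^ n := by
    rw [AlgHom.coe_pow, hF, FiniteField.coe_frobeniusAlgHom, pow_iterate, ZMod.card]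
  have hmod (n : ℕ) : F ^ (n % m) = F ^ n := by
    conv_lhs => rw [← hord]
    exact pow_mod_orderOf F n
  have hinj : Function.Injective fun i : ZMod m => F ^ i.val := fun i j hij => by
    have h := (FiniteField.bijective_frobeniusAlgHom_pow (ZMod p) L).1
      (a₁ := ⟨i.val, hrank ▸ i.val_lt⟩) (a₂ := ⟨j.val, hrank ▸ j.val_lt⟩) hij
    exact ZMod.val_injective m (congrArg Fin.val h)
  have hind := (linearIndependent_algHom_toLinearMap (ZMod p) L L).comp _ hinj
  rw [Fintype.linearIndependent_iff] at hind
  have hzero (c : ZMod m → L) (h : ∀ x, ∑ i, c i * (F ^ i.val) x = 0) : c = 0 := by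
    funext i
    refine hind c (LinearMap.ext fun x => ?_) i
    simpa using h x
  let T : (ZMod m → L) → (L →ₗ[ZMod p] L) := fun c => ∑ i, c i • (F ^ i.val).toLinearMap
  have hT c x : T c x = ∑ i, c i * (F ^ i.val) x := by simp [T]
  have hTinj : Function.Injective T := fun c d h => by
    refine sub_eq_zero.mp (hzero (c - d) fun x => ?_)
    have := LinearMap.congr_fun h x
    rw [hT, hT, ← sub_eq_zero, ← Finset.sum_sub_distrib] at this
    simpa [sub_mul] using this
  have : Finite (L →ₗ[ZMod p] L) := DFunLike.finite _
  -- Independence makes `T` injective; both sides have `p ^ (m * m)` elements, so the Frobenius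
  -- powers also span.
  have hcard : Nat.card (L →ₗ[ZMod p] L) = Nat.card (ZMod m → L) := by
    rw [Module.natCard_eq_pow_finrank (K := ZMod p), Module.finrank_linearMap, hrank, Nat.card_fun,
      hL, Nat.card_zmod, Nat.card_zmod, pow_mul]
  have hTsurj := (hTinj.bijective_of_nat_card_le hcard.le).2
  refine ⟨⟨fun i => F ^ i.val, fun i j x => ?_, fun x => by simp, hzero, fun f => ?_⟩,
    fun n x => ?_⟩
  · rw [ZMod.val_add, hmod, pow_add]
    rfl
  · obtain ⟨c, rfl⟩ := hTsurj f
    exact ⟨c, hT c⟩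
  · change (F ^ (n : ZMod m).val) x = _
    rw [ZMod.val_natCast, hmod, hpow]

/-! ### Reduction of both families to the common form -/

namespace FrobeniusSystem

variable {p m : ℕ} [NeZero m] {L : Type*} [Field L] [Algebra (ZMod p) L]
  (Φ : FrobeniusSystem p m L)

/-- The common form of `mulS σ τ α η` and `mulS' σ τ α η`, where `θ` is `η` or `η ^ τ⁻¹`. -/
theorem not_isotopic_of_ne_zero {s t : ZMod m} {α₁ η₁ θ₁ α₂ η₂ θ₂ : L}
    (hs : s ≠ 0) (hs2 : s + s ≠ 0) (hst : s ≠ t) (hst' : s + t ≠ 0) (hst2 : s + s ≠ t + t)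
    (ht : t = 0 ∨ t + t ≠ 0) (hα₁ : α₁ ≠ 0) (hα₂ : α₂ ≠ 0) (hηθ : η₂ = 0 → θ₂ = 0)
    (hη : t = 0 → η₂ ≠ 1 ∧ θ₂ ≠ 1) :
    ¬ Isotopic p (Φ.mul s t 1 (-η₁) α₁ (-(α₁ * θ₁))) (Φ.mul t s 1 (-η₂) α₂ (-(α₂ * θ₂))) := by
  rcases eq_or_ne t 0 with rfl | ht0
  -- For trivial `t` the two monomials of each pair coincide and merge, which reduces to `b₂ = d₂ =
  -- 0`.
  · have : Φ.mul 0 s 1 (-η₂) α₂ (-(α₂ * θ₂)) = Φ.mul 0 s (1 - η₂) 0 (α₂ * (1 - θ₂)) 0 := by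
      funext x y
      simp only [mul, frob_zero]
      congr 1
      ring
    rw [this]
    obtain ⟨h1, h2⟩ := hη rfl
    exact Φ.not_isotopic_mul hs hs2 hst hst' hst2 ht one_ne_zero hα₁
      (sub_ne_zero.mpr h1.symm) (mul_ne_zero hα₂ (sub_ne_zero.mpr h2.symm)) (Or.inl ⟨rfl, rfl⟩)
  · refine Φ.not_isotopic_mul hs hs2 hst hst' hst2 ht one_ne_zero hα₁ one_ne_zero hα₂ ?_
    by_cases h : η₂ = 0
    · exact Or.inl (by simp [h, hηθ h])
    · exact Or.inr ⟨by simpa using h, ht0⟩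

/-- The squares of `(1, 0)` and `(0, 1)` are `(α (1 - θ), 0)` and `(1 - η, 0)`. -/
theorem ne_of_isPresemifield {s t : ZMod m} {α η θ : L}
    (h : IsPresemifield (Φ.mul s t 1 (-η) α (-(α * θ)))) : α ≠ 0 ∧ η ≠ 1 ∧ θ ≠ 1 := by
  refine ⟨?_, ?_, ?_⟩
  · rintro rfl
    simpa using h.eq_zero_or_eq_zero (1, 0) (1, 0) (by simp [mul])
  · rintro rfl
    simpa using h.eq_zero_or_eq_zero (0, 1) (0, 1) (by simp [mul])
  · rintro rfl
    simpa using h.eq_zero_or_eq_zero (1, 0) (1, 0) (by simp [mul])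

theorem not_isotopic_of_isPresemifield {k l : ℕ} {α₁ η₁ θ₁ α₂ η₂ θ₂ : L}
    (hk : 2 * k < m) (hl : 2 * l < m) (hkl : k ≠ l)
    (hηθ₁ : η₁ = 0 → θ₁ = 0) (hηθ₂ : η₂ = 0 → θ₂ = 0)
    (h₁ : IsPresemifield (Φ.mul k l 1 (-η₁) α₁ (-(α₁ * θ₁))))
    (h₂ : IsPresemifield (Φ.mul l k 1 (-η₂) α₂ (-(α₂ * θ₂)))) :
    ¬ Isotopic p (Φ.mul k l 1 (-η₁) α₁ (-(α₁ * θ₁))) (Φ.mul l k 1 (-η₂) α₂ (-(α₂ * θ₂))) := by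
  obtain ⟨hα₁, h3, h4⟩ := Φ.ne_of_isPresemifield h₁
  obtain ⟨hα₂, h5, h6⟩ := Φ.ne_of_isPresemifield h₂
  -- The bounds on `k` and `l` keep `k + l`, `2k` and `2l` below `m`, so inequalities of integers
  -- survive in `ZMod m`.
  have hcast (a b : ℕ) (ha : a < m) (hb : b < m) (hab : a ≠ b) : (a : ZMod m) ≠ b := fun h => by
    rw [ZMod.natCast_eq_natCast_iff', Nat.mod_eq_of_lt ha, Nat.mod_eq_of_lt hb] at h
    exact hab h
  have hkl' : (k : ZMod m) ≠ l := hcast k l (by lia) (by lia) hkl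
  have hsum : (k : ZMod m) + l ≠ 0 := by
    exact_mod_cast hcast (k + l) 0 (by lia) (by lia) (by lia)
  have hdbl : (k : ZMod m) + k ≠ l + l := by
    exact_mod_cast hcast (k + k) (l + l) (by lia) (by lia) (by lia)
  have hne (n : ℕ) (hn : 2 * n < m) (h0 : n ≠ 0) : (n : ZMod m) ≠ 0 ∧ (n : ZMod m) + n ≠ 0 :=
    ⟨by exact_mod_cast hcast n 0 (by lia) (by lia) h0,
      by exact_mod_cast hcast (n + n) 0 (by lia) (by lia) (by lia)⟩
  have hor (n : ℕ) (hn : 2 * n < m) : (n : ZMod m) = 0 ∨ (n : ZMod m) + n ≠ 0 := by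
    rcases eq_or_ne n 0 with rfl | h0
    · simp
    · exact Or.inr (hne n hn h0).2
  -- The argument needs the first exponent nonzero; if `k = 0`, the two products are exchanged.
  rcases eq_or_ne k 0 with h0 | h0
  · have hl0 : l ≠ 0 := fun h => hkl (h0.trans h.symm)
    exact fun h => Φ.not_isotopic_of_ne_zero (hne l hl hl0).1 (hne l hl hl0).2 hkl'.symm
      (by rwa [add_comm]) hdbl.symm (hor k hk) hα₂ hα₁ hηθ₁ (fun _ => ⟨h3, h4⟩) (isotopic_symm h)
  · exact Φ.not_isotopic_of_ne_zero (hne k hk h0).1 (hne k hk h0).2 hkl' hsum hdbl (hor l hl)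
      hα₁ hα₂ hηθ₂ fun _ => ⟨h5, h6⟩

theorem mulS_eq {k l : ℕ} {σ τ : L ≃ₐ[ZMod p] L} (hσ : ∀ x, σ x = Φ.frob k x)
    (hτ : ∀ x, τ x = Φ.frob l x) (α η : L) :
    mulS σ τ α η = Φ.mul k l 1 (-η) α (-(α * η)) := by
  funext x y
  simp only [mulS, mul, hσ, hτ]
  congr 1
  ring

theorem mulS'_eq {k l : ℕ} {σ τ : L ≃ₐ[ZMod p] L} (hσ : ∀ x, σ x = Φ.frob k x)
    (hτ : ∀ x, τ x = Φ.frob l x) (α η : L) :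
    mulS' σ τ α η = Φ.mul k l 1 (-η) α (-(α * τ.symm η)) := by
  funext x y
  simp only [mulS', mul, hσ, hτ]
  congr 1
  ring

end FrobeniusSystem

theorem mainTheorem12 (p m k l : ℕ) [Fact p.Prime] {L : Type*} [Field L] [Algebra (ZMod p) L]
    (hL : Nat.card L = p ^ m) (σ τ : L ≃ₐ[ZMod p] L)
    (hσ : ∀ x, σ x = x ^ p ^ k) (hτ : ∀ x, τ x = x ^ p ^ l)
    (hk : 2 * k < m) (hl : 2 * l < m) (hkl : k ≠ l) (α₁ η₁ α₂ η₂ : L) :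
    (IsPresemifield (mulS σ τ α₁ η₁) → IsPresemifield (mulS τ σ α₂ η₂) →
      ¬ Isotopic p (mulS σ τ α₁ η₁) (mulS τ σ α₂ η₂)) ∧
    (IsPresemifield (mulS' σ τ α₁ η₁) → IsPresemifield (mulS' τ σ α₂ η₂) →
      ¬ Isotopic p (mulS' σ τ α₁ η₁) (mulS' τ σ α₂ η₂)) := by
  have : NeZero m := ⟨by lia⟩
  obtain ⟨Φ, hΦ⟩ := exists_frobeniusSystem (p := p) hL
  have hσ' x : σ x = Φ.frob k x := (hσ x).trans (hΦ k x).symm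
  have hτ' x : τ x = Φ.frob l x := (hτ x).trans (hΦ l x).symm
  rw [Φ.mulS_eq hσ' hτ', Φ.mulS_eq hτ' hσ', Φ.mulS'_eq hσ' hτ', Φ.mulS'_eq hτ' hσ']
  exact ⟨Φ.not_isotopic_of_isPresemifield hk hl hkl id id,
    Φ.not_isotopic_of_isPresemifield hk hl hkl (fun h => by simp [h]) (fun h => by simp [h])⟩
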